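/- Let $(p_j)_{j\ge1}$ be numbers with $0\le p_j<1$, and consider the random directed graph on $\mathbb Z$ in which, for each pair of integers $i<j$, there is an edge from $i$ to $j$ with probability $p_{j-i}$, independently over all pairs. For $i<j$ write $i\leadsto j$ if there is a path of present edges $i=i_0<i_1<\dots<i_\ell=j$ with $\ell\ge1$. Let $$\mathscr S=\{n\in\mathbb Z:\ n\leadsto j\text{ for all }j>n\ \text{ and }\ j\leadsto n\text{ for all }j<n\}$$ be the skeleton, and let $\Gamma_0=\max(\mathscr S\cap(-\infty,0])$ be its largest non-positive element. For $j\in\mathbb Z$ let $\xi(j)=\min\{k\ge1:\ (j-k,j)\text{ is an edge}\}$, with $\xi(j)=\infty$ if there is no such $k$; the $\xi(j)$ all have the same law. Consider the conditions [C1] $0<p_1<1$, [C3] $\displaystyle\sum_{k=1}^\infty k\,(1-p_1)\cdots(1-p_k)<\infty$. Condition [C3] is equivalent to $\mathbb E\,\xi(j)^2<\infty$ (for every $j\in\mathbb Z$). If [C1] and [C3] hold, then $\Gamma_0$ is almost surely well defined (that is, $\mathscr S\cap(-\infty,0]$ is almost surely non-empty) and $$\mathbb E|\Gamma_0|<\infty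 .$$ -/

import Mathlib

open MeasureTheory ProbabilityTheory
open scoped ENNReal

namespace LineModel

/-- The line model: a random directed graph on `ℤ` in which `edge i j` (only `i < j` matters) is the
event that the edge from `i` to `j` is present, i.e. `α i j = 1` (outside it, `α i j = -∞`).
These events are mutually independent and `edge i j` has probability `p (j - i)`. -/
structure IsLineModel (p : ℕ → ℝ) {Ω : Type*} [MeasurableSpace Ω] (P : Measure Ω)
    (edge : ℤ → ℤ → Set Ω) : Prop where
  measurableSet_edge : ∀ i j : ℤ, i < j → MeasurableSet (edge i j)
  indep : iIndepSet (fun e : {e : ℤ × ℤ // e.1 < e.2} => edge e.1.1 e.1.2) P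
  prob_edge : ∀ i j : ℤ, i < j → P (edge i j) = ENNReal.ofReal (p (j - i).toNat)

/-- Condition C1: `0 < p₁ < 1`. -/
def CondC1 (p : ℕ → ℝ) : Prop := 0 < p 1 ∧ p 1 < 1

/-- Condition C3: `∑_{k ≥ 1} k (1 - p₁) ⋯ (1 - p_k) < ∞` (the term `k = 0` vanishes). -/
def CondC3 (p : ℕ → ℝ) : Prop :=
  Summable fun k : ℕ => (k : ℝ) * ∏ i ∈ Finset.Icc 1 k, (1 - p i)

variable {Ω : Type*}

/-- There is a path `i = i₀ < i₁ < ⋯ < i_ℓ = j` with `ℓ ≥ 1`, all of whose edges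
`(i_{r-1}, i_r)` are present in the configuration `ω`. -/
def Leads (edge : ℤ → ℤ → Set Ω) (ω : Ω) (i j : ℤ) : Prop :=
  Relation.TransGen (fun a b : ℤ => a < b ∧ ω ∈ edge a b) i j

/-- The skeleton: the vertices `n` from which every `j > n` is reachable, and which are reachable
from every `j < n`. -/
def skeleton (edge : ℤ → ℤ → Set Ω) (ω : Ω) : Set ℤ :=
  {n | (∀ j, n < j → Leads edge ω n j) ∧ (∀ j, j < n → Leads edge ω j n)}

/-- `Γ₀`, the largest non-positive skeleton point (the value is arbitrary where there is none). -/
noncomputable def gammaZero (edge : ℤ → ℤ → Set Ω) (ω : Ω) : ℤ :=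
  sSup (skeleton edge ω ∩ Set.Iic 0)

/-- `ξ(j)`, the distance from `j` to the closest `i < j` such that the edge `(i, j)` is present
(`∞` if there is no such `i`). -/
noncomputable def xi (edge : ℤ → ℤ → Set Ω) (j : ℤ) (ω : Ω) : ℕ∞ :=
  ⨅ (k : ℕ) (_ : 1 ≤ k ∧ ω ∈ edge (j - k) j), (k : ℕ∞)

end LineModel

/-! Membership of `n` in the skeleton splits into two conditions on single edges, `fed` and
`drained` (`mem_skeleton_iff`). The proof searches leftwards from 0 for such a vertex and bounds the
expected length of the search by two renewal arguments, both instances of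
`setLIntegral_le_of_regeneration`.

Feeding (`lintegral_feedDist_le`): reveal the edges ending to the right of `n`. They need sources
only down to `n - r`, where `r` is the `reach`, and a union bound gives an expected `reach` of at
most `∑ k * tail p k`. It remains to feed the vertices of `(n - r, n]`, which involves only edges
ending at or before `n`, hence independent ones. With probability at least `c > 0` nothing has to be
done, so the worst expectation `s` satisfies `s ≤ ∑ k * tail p k + (1 - c) * s`.

Skeleton (`lintegral_skelDist_le`): in the graph on `(-∞, n]`, the vertex `n` is a skeleton point
once it is drained. Otherwise take the closest `v = n - k` with no edge into `(v, n]`, and move on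
to some `v - t` that feeds all of `(v - t, n]`. Only edges inside `[v - t, n]` have been used, so
the search restarts independently. The cost `k + t` must be summed over `k` on the events `noOut`,
which are correlated with the missing incoming edges; `measure_noOut_inter_noIn_le` controls this,
and [C3] makes the sum finite. The probability of restarting is again at most `1 - c`.

One more feeding step passes from half-lines to the whole line (`lintegral_skelDist_univ_ne_top`).
The second-moment criterion is the layer formula for `ξ²`. -/

namespace LineModel

/-! ### First hitting indices and the abstract regeneration inequality. -/

section Hitting

variable {Ω : Type*}

/-- The first index `t` with `ω ∈ A t`, as an extended nonnegative real. -/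
noncomputable def hit (A : ℕ → Set Ω) (ω : Ω) : ℝ≥0∞ :=
  ⨅ (t : ℕ) (_ : ω ∈ A t), (t : ℝ≥0∞)

theorem hit_le {A : ℕ → Set Ω} {ω : Ω} {t : ℕ} (h : ω ∈ A t) : hit A ω ≤ t :=
  iInf₂_le t h

theorem hit_eq_top {A : ℕ → Set Ω} {ω : Ω} (h : ∀ t, ω ∉ A t) : hit A ω = ∞ := by
  simp [hit, h]

theorem mem_disjointed_iff {A : ℕ → Set Ω} {ω : Ω} {t : ℕ} :
    ω ∈ disjointed A t ↔ ω ∈ A t ∧ ∀ s < t, ω ∉ A s := by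
  simp [disjointed_eq_inter_compl]

theorem hit_eq_of_mem_disjointed {A : ℕ → Set Ω} {ω : Ω} {t : ℕ} (h : ω ∈ disjointed A t) :
    hit A ω = t := by
  rw [mem_disjointed_iff] at h
  refine le_antisymm (hit_le h.1) (le_iInf₂ fun s hs => ?_)
  have : t ≤ s := not_lt.1 fun hlt => h.2 s hlt hs
  exact_mod_cast this

theorem exists_mem_disjointed {A : ℕ → Set Ω} {ω : Ω} (h : ∃ t, ω ∈ A t) :
    ∃ t, ω ∈ disjointed A t := by
  have : ω ∈ ⋃ t, disjointed A t := by rw [iUnion_disjointed]; simpa using h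
  simpa using this

/-- The stopping-time property: only the sets up to `t` matter, which allows a σ-algebra that itself
depends on `t`. -/
theorem measurableSet_disjointed {m : MeasurableSpace Ω} {A : ℕ → Set Ω} {t : ℕ}
    (h : ∀ s ≤ t, MeasurableSet (A s)) : MeasurableSet (disjointed A t) := by
  rw [disjointed_eq_inter_compl]
  exact (h t le_rfl).inter
    (MeasurableSet.iInter fun s => MeasurableSet.iInter fun hs => (h s hs.le).compl)

theorem lintegral_eq_setLIntegral_of_eq_zero [MeasurableSpace Ω] {P : Measure Ω} {G : Set Ω}
    (hGm : MeasurableSet G) {V : Ω → ℝ≥0∞} (h : ∀ ω ∉ G, V ω = 0) :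
    ∫⁻ ω, V ω ∂P = ∫⁻ ω in G, V ω ∂P := by
  rw [← lintegral_indicator hGm]
  refine lintegral_congr fun ω => ?_
  by_cases hω : ω ∈ G
  · rw [Set.indicator_of_mem hω]
  · rw [Set.indicator_of_notMem hω, h ω hω]

theorem hit_le_add_hit {A A' : ℕ → Set Ω} {ω : Ω} {r : ℕ}
    (h : ∀ s, ω ∈ A' s → ω ∈ A (r + s)) : hit A ω ≤ r + hit A' ω := by
  by_cases hex : ∃ t, ω ∈ A' t
  · obtain ⟨t, ht⟩ := exists_mem_disjointed hex
    rw [hit_eq_of_mem_disjointed ht]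
    exact_mod_cast hit_le (h t (mem_disjointed_iff.1 ht).1)
  · rw [hit_eq_top (A := A') (not_exists.1 hex)]
    simp

/-- Every index before the first hit contributes 1. Without monotonicity of `A`, later indices may
contribute too, hence only an inequality. -/
theorem hit_le_tsum_indicator (A : ℕ → Set Ω) (ω : Ω) :
    hit A ω ≤ ∑' r, (A r)ᶜ.indicator 1 ω := by
  by_cases hex : ∃ t, ω ∈ A t
  · obtain ⟨t, ht⟩ := exists_mem_disjointed hex
    rw [hit_eq_of_mem_disjointed ht]
    rw [mem_disjointed_iff] at ht
    calc (t : ℝ≥0∞) = ∑ r ∈ Finset.range t, (A r)ᶜ.indicator 1 ω := by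
          rw [Finset.sum_congr rfl fun r hr => Set.indicator_of_mem (s := (A r)ᶜ)
            (ht.2 r (Finset.mem_range.1 hr)) (1 : Ω → ℝ≥0∞)]
          simp
      _ ≤ _ := ENNReal.sum_le_tsum _
  · have : ∀ r, (A r)ᶜ.indicator (1 : Ω → ℝ≥0∞) ω = 1 := fun r =>
      Set.indicator_of_mem (s := (A r)ᶜ) (fun h => hex ⟨r, h⟩) _
    simp [this]

theorem measurable_hit {m : MeasurableSpace Ω} {A : ℕ → Set Ω} (hA : ∀ t, MeasurableSet (A t)) :
    Measurable (hit A) := by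
  classical
  have : hit A = fun ω => ⨅ t : ℕ, if ω ∈ A t then (t : ℝ≥0∞) else ∞ := by
    ext ω
    refine iInf_congr fun t => ?_
    split_ifs with h <;> simp [h]
  rw [this]
  exact Measurable.iInf fun t => Measurable.ite (hA t) measurable_const measurable_const

theorem setLIntegral_hit_le [MeasurableSpace Ω] {P : Measure Ω} {A : ℕ → Set Ω}
    (hA : ∀ t, MeasurableSet (A t)) {G : Set Ω} :
    ∫⁻ ω in G, hit A ω ∂P ≤ ∑' r, P (G ∩ (A r)ᶜ) := by
  calc ∫⁻ ω in G, hit A ω ∂P ≤ ∫⁻ ω in G, ∑' r, (A r)ᶜ.indicator 1 ω ∂P :=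
        lintegral_mono fun ω => hit_le_tsum_indicator A ω
    _ = ∑' r, P (G ∩ (A r)ᶜ) := by
        rw [lintegral_tsum fun r => (measurable_one.indicator (hA r).compl).aemeasurable]
        refine tsum_congr fun r => ?_
        rw [lintegral_indicator_one (hA r).compl, Measure.restrict_apply (hA r).compl,
          Set.inter_comm]

theorem setLIntegral_eq_mul_of_indep {mΩ : MeasurableSpace Ω} {P : Measure Ω}
    {m₁ m₂ : MeasurableSpace Ω} (h₁ : m₁ ≤ mΩ) (h₂ : m₂ ≤ mΩ) (hind : Indep m₁ m₂ P)
    {S : Set Ω} (hS : MeasurableSet[m₁] S) {U : Ω → ℝ≥0∞} (hU : Measurable[m₂] U) :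
    ∫⁻ ω in S, U ω ∂P = P S * ∫⁻ ω, U ω ∂P := by
  have hi : Measurable[m₁] (S.indicator (1 : Ω → ℝ≥0∞)) :=
    Measurable.indicator measurable_const hS
  have := lintegral_mul_eq_lintegral_mul_lintegral_of_independent_measurableSpace h₁ h₂ hind hi hU
  rw [lintegral_indicator_one (h₁ _ hS)] at this
  rw [← this, ← lintegral_indicator (h₁ _ hS)]
  refine lintegral_congr fun ω => ?_
  by_cases h : ω ∈ S <;> simp [h]

/-- If, on the event that `t` is the first index with `ω ∈ A t`, the variable `V` is at most
`c + t` plus a variable `U t` that is independent of this event, then the expectation of `V` is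
bounded by the sum of the expectations. -/
theorem setLIntegral_le_of_regeneration {mΩ : MeasurableSpace Ω} {P : Measure Ω}
    {A : ℕ → Set Ω} {G : Set Ω} {V : Ω → ℝ≥0∞} {U : ℕ → Ω → ℝ≥0∞} {c K : ℝ≥0∞}
    (m₁ m₂ : ℕ → MeasurableSpace Ω) (h₁ : ∀ t, m₁ t ≤ mΩ) (h₂ : ∀ t, m₂ t ≤ mΩ)
    (hind : ∀ t, Indep (m₁ t) (m₂ t) P) (hG : ∀ t, MeasurableSet[m₁ t] G)
    (hA : ∀ t, MeasurableSet[m₁ t] (disjointed A t)) (hAm : ∀ t, MeasurableSet (A t))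
    (hU : ∀ t, Measurable[m₂ t] (U t)) (hK : ∀ t, ∫⁻ ω, U t ω ∂P ≤ K)
    (hV : ∀ t ω, ω ∈ G → ω ∈ disjointed A t → V ω ≤ c + t + U t ω) :
    ∫⁻ ω in G, V ω ∂P ≤ c * P G + ∫⁻ ω in G, hit A ω ∂P + P G * K := by
  have hGm : MeasurableSet G := h₁ 0 _ (hG 0)
  have hm : ∀ t, MeasurableSet (disjointed A t) := fun t => h₁ t _ (hA t)
  have hpt : ∀ ω ∈ G, V ω ≤ c + hit A ω + ∑' t, (disjointed A t).indicator (U t) ω := by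
    intro ω hω
    by_cases hex : ∃ t, ω ∈ A t
    · obtain ⟨t, ht⟩ := exists_mem_disjointed hex
      rw [hit_eq_of_mem_disjointed ht]
      refine (hV t ω hω ht).trans (add_le_add le_rfl ?_)
      refine le_trans ?_ (ENNReal.le_tsum t)
      rw [Set.indicator_of_mem ht]
    -- If no index is hit, the right side is infinite, so no almost sure existence is needed
    -- beforehand.
    · rw [hit_eq_top (not_exists.1 hex)]
      simp
  calc ∫⁻ ω in G, V ω ∂P
      ≤ ∫⁻ ω in G, (c + hit A ω + ∑' t, (disjointed A t).indicator (U t) ω) ∂P :=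
        setLIntegral_mono' hGm hpt
    _ = c * P G + ∫⁻ ω in G, hit A ω ∂P + ∑' t, P (G ∩ disjointed A t) * ∫⁻ ω, U t ω ∂P := by
        have hc : Measurable fun ω => c + hit A ω := measurable_const.add (measurable_hit hAm)
        rw [lintegral_add_left hc, lintegral_add_left measurable_const, setLIntegral_const, lintegral_tsum fun t =>
            (((hU t).mono (h₂ t) le_rfl).indicator (hm t)).aemeasurable]
        congr 1
        refine tsum_congr fun t => ?_
        rw [lintegral_indicator (hm t), Measure.restrict_restrict (hm t), Set.inter_comm,
          setLIntegral_eq_mul_of_indep (h₁ t) (h₂ t) (hind t)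
            (MeasurableSet.inter (hG t) (hA t)) (hU t)]
    _ ≤ c * P G + ∫⁻ ω in G, hit A ω ∂P + P G * K := by
        refine add_le_add le_rfl ?_
        -- The first-hit events are disjoint inside `G`, so their probabilities add up to at most `P
        -- G`; this factor later becomes the contraction `1 - c`.
        calc ∑' t, P (G ∩ disjointed A t) * ∫⁻ ω, U t ω ∂P
            ≤ ∑' t, P (G ∩ disjointed A t) * K := ENNReal.tsum_le_tsum fun t => by
              gcongr; exact hK t
          _ = P (⋃ t, G ∩ disjointed A t) * K := by
              rw [ENNReal.tsum_mul_right, measure_iUnion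
                (fun i j hij => ((disjoint_disjointed A hij).mono Set.inter_subset_right
                  Set.inter_subset_right)) fun t => hGm.inter (hm t)]
          _ ≤ P G * K := by
              gcongr
              exact Set.iUnion_subset fun t => Set.inter_subset_left

/-- Truncation keeps the suprema in the renewal arguments finite, as `le_div_of_le_add_one_sub_mul`
requires; monotone convergence removes it. -/
theorem lintegral_le_of_forall_min_le [MeasurableSpace Ω] {P : Measure Ω} {f : Ω → ℝ≥0∞}
    (hf : Measurable f) {C : ℝ≥0∞} (h : ∀ N : ℕ, ∫⁻ ω, min (f ω) N ∂P ≤ C) :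
    ∫⁻ ω, f ω ∂P ≤ C := by
  have : ∀ ω, f ω = ⨆ N : ℕ, min (f ω) N := by
    intro ω
    rw [← inf_iSup_eq, ENNReal.iSup_natCast, inf_top_eq]
  rw [lintegral_congr this, lintegral_iSup (fun N => hf.min measurable_const)]
  · exact iSup_le h
  · intro M N hMN ω
    exact min_le_min le_rfl (by exact_mod_cast hMN)

theorem min_add_le_add_min (a b K : ℝ≥0∞) : min (a + b) K ≤ a + min b K := by
  rcases le_total b K with h | h
  · rw [min_eq_left h]; exact min_le_left _ _
  · rw [min_eq_right h]; exact (min_le_right _ _).trans le_add_self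

/-- Solving the inequality `s ≤ C + (1 - c) s` for a finite `s`. -/
theorem le_div_of_le_add_one_sub_mul {s C c : ℝ≥0∞} (hs : s ≠ ∞) (hc : c ≠ 0) (hc1 : c ≤ 1)
    (h : s ≤ C + (1 - c) * s) : s ≤ C / c := by
  have hct : c ≠ ∞ := ne_top_of_le_ne_top ENNReal.one_ne_top hc1
  rw [ENNReal.le_div_iff_mul_le (Or.inl hc) (Or.inl hct)]
  have h1 : s * c + (1 - c) * s = s := by
    rw [mul_comm s c, ← add_mul, add_tsub_cancel_of_le hc1, one_mul]
  have h2 : (1 - c) * s ≠ ∞ := ENNReal.mul_ne_top (by simp) hs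
  rw [← ENNReal.add_le_add_iff_right h2, h1]
  exact h

end Hitting

/-! ### Feeding and draining events, their σ-algebras and probabilities. -/

section EdgeEvents

variable {Ω : Type*}

/-- The σ-algebra generated by the edges in `S`. -/
abbrev edgeSigma (edge : ℤ → ℤ → Set Ω) (S : Set (ℤ × ℤ)) : MeasurableSpace Ω :=
  MeasurableSpace.generateFrom {t | ∃ e ∈ {e : {e : ℤ × ℤ // e.1 < e.2} | e.1 ∈ S},
    edge e.1.1 e.1.2 = t}

/-- Every vertex `j ∈ B` to the right of `m` has an incoming edge from `[n, j)`. -/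
def fed (edge : ℤ → ℤ → Set Ω) (n m : ℤ) (B : Set ℤ) : Set Ω :=
  {ω | ∀ j ∈ B, m < j → ∃ i, n ≤ i ∧ i < j ∧ ω ∈ edge i j}

/-- Every vertex `i` to the left of `n` has an outgoing edge into `(i, n]`. -/
def drained (edge : ℤ → ℤ → Set Ω) (n : ℤ) : Set Ω :=
  {ω | ∀ i, i < n → ∃ j, i < j ∧ j ≤ n ∧ ω ∈ edge i j}

/-- The vertex `j` has no incoming edge of length at most `l`. -/
def noIn (edge : ℤ → ℤ → Set Ω) (j : ℤ) (l : ℕ) : Set Ω :=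
  {ω | ∀ i, j - l ≤ i → i < j → ω ∉ edge i j}

/-- The vertex `i` has no outgoing edge of length at most `l`. -/
def noOut (edge : ℤ → ℤ → Set Ω) (i : ℤ) (l : ℕ) : Set Ω :=
  {ω | ∀ j, i < j → j ≤ i + l → ω ∉ edge i j}

/-- The distance from `n` to the closest `n - s` such that all `j ∈ B` with `j > n - s` have an
incoming edge from `[n - s, j)`. -/
noncomputable def feedDist (edge : ℤ → ℤ → Set Ω) (n : ℤ) (B : Set ℤ) : Ω → ℝ≥0∞ :=
  hit fun s : ℕ => fed edge (n - s) (n - s) B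

/-- The distance from `n` to the closest `n - r` such that all `j ∈ B` with `j > n` have an
incoming edge from `[n - r, j)`. -/
noncomputable def reach (edge : ℤ → ℤ → Set Ω) (n : ℤ) (B : Set ℤ) : Ω → ℝ≥0∞ :=
  hit fun r : ℕ => fed edge (n - r) n B

/-- The distance from `n` to the closest skeleton point on its left of the graph restricted to
`B`, for `B` unbounded to the left. -/
noncomputable def skelDist (edge : ℤ → ℤ → Set Ω) (n : ℤ) (B : Set ℤ) : Ω → ℝ≥0∞ :=
  hit fun t : ℕ => fed edge (n - t) (n - t) B ∩ drained edge (n - t)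

variable {edge : ℤ → ℤ → Set Ω}

theorem edgeSigma_mono {S S' : Set (ℤ × ℤ)} (h : ∀ i j, i < j → (i, j) ∈ S → (i, j) ∈ S') :
    edgeSigma edge S ≤ edgeSigma edge S' := by
  refine MeasurableSpace.generateFrom_mono ?_
  rintro t ⟨e, he, rfl⟩
  exact ⟨e, h _ _ e.2 he, rfl⟩

theorem measurableSet_edgeSigma {S : Set (ℤ × ℤ)} {i j : ℤ} (hij : i < j) (h : (i, j) ∈ S) :
    MeasurableSet[edgeSigma edge S] (edge i j) :=
  MeasurableSpace.measurableSet_generateFrom ⟨⟨(i, j), hij⟩, h, rfl⟩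

theorem measurableSet_fed {S : Set (ℤ × ℤ)} {n m : ℤ} {B : Set ℤ}
    (h : ∀ i j, i < j → n ≤ i → m < j → j ∈ B → (i, j) ∈ S) :
    MeasurableSet[edgeSigma edge S] (fed edge n m B) := by
  have : fed edge n m B = ⋂ (j : ℤ) (_ : j ∈ B) (_ : m < j), ⋃ (i : ℤ) (_ : n ≤ i) (_ : i < j),
      edge i j := by
    ext ω; simp [fed, and_left_comm]
  rw [this]
  refine MeasurableSet.iInter fun j => MeasurableSet.iInter fun hj => MeasurableSet.iInter
    fun hm => MeasurableSet.iUnion fun i => MeasurableSet.iUnion fun hi => MeasurableSet.iUnion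
    fun hij => measurableSet_edgeSigma hij (h i j hij hi hm hj)

theorem measurableSet_drained {S : Set (ℤ × ℤ)} {n : ℤ}
    (h : ∀ i j, i < j → j ≤ n → (i, j) ∈ S) :
    MeasurableSet[edgeSigma edge S] (drained edge n) := by
  have : drained edge n = ⋂ (i : ℤ) (_ : i < n), ⋃ (j : ℤ) (_ : i < j) (_ : j ≤ n),
      edge i j := by
    ext ω; simp [drained, and_left_comm]
  rw [this]
  refine MeasurableSet.iInter fun i => MeasurableSet.iInter fun hi => MeasurableSet.iUnion
    fun j => MeasurableSet.iUnion fun hij => MeasurableSet.iUnion fun hj =>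
      measurableSet_edgeSigma hij (h i j hij hj)

theorem measurableSet_noIn {S : Set (ℤ × ℤ)} {j : ℤ} {l : ℕ}
    (h : ∀ i, j - l ≤ i → i < j → (i, j) ∈ S) :
    MeasurableSet[edgeSigma edge S] (noIn edge j l) := by
  have : noIn edge j l = ⋂ (i : ℤ) (_ : j - l ≤ i) (_ : i < j), (edge i j)ᶜ := by
    ext ω; simp [noIn]
  rw [this]
  exact MeasurableSet.iInter fun i => MeasurableSet.iInter fun hi => MeasurableSet.iInter
    fun hij => (measurableSet_edgeSigma hij (h i hi hij)).compl

theorem measurableSet_noOut {S : Set (ℤ × ℤ)} {i : ℤ} {l : ℕ}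
    (h : ∀ j, i < j → j ≤ i + l → (i, j) ∈ S) :
    MeasurableSet[edgeSigma edge S] (noOut edge i l) := by
  have : noOut edge i l = ⋂ (j : ℤ) (_ : i < j) (_ : j ≤ i + l), (edge i j)ᶜ := by
    ext ω; simp [noOut]
  rw [this]
  exact MeasurableSet.iInter fun j => MeasurableSet.iInter fun hij => MeasurableSet.iInter
    fun hj => (measurableSet_edgeSigma hij (h j hij hj)).compl

theorem measurable_skelDist {S : Set (ℤ × ℤ)} {n : ℤ} {B : Set ℤ}
    (h : ∀ i j, i < j → j ∈ B ∨ j ≤ n → (i, j) ∈ S) :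
    Measurable[edgeSigma edge S] (skelDist edge n B) := by
  refine measurable_hit fun t => MeasurableSet.inter ?_ ?_
  · exact measurableSet_fed fun i j hij _ _ hj => h i j hij (Or.inl hj)
  · exact measurableSet_drained fun i j hij hj => h i j hij (Or.inr (by omega))

theorem measurable_feedDist {S : Set (ℤ × ℤ)} {n : ℤ} {B : Set ℤ}
    (h : ∀ i j, i < j → j ∈ B → (i, j) ∈ S) :
    Measurable[edgeSigma edge S] (feedDist edge n B) :=
  measurable_hit fun _ => measurableSet_fed fun i j hij _ _ hj => h i j hij hj

theorem fed_trans {n n' m : ℤ} {B : Set ℤ} (hn : n ≤ n') {ω : Ω}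
    (h : ω ∈ fed edge n n (Set.Iic m)) (h' : ω ∈ fed edge n' m B) : ω ∈ fed edge n n B := by
  intro j hj hnj
  rcases le_or_gt j m with hjm | hjm
  · exact h j hjm hnj
  · obtain ⟨i, hi, hij, he⟩ := h' j hj hjm
    exact ⟨i, hn.trans hi, hij, he⟩

theorem feedDist_le {n : ℤ} {B : Set ℤ} {r : ℕ} {ω : Ω} (h : ω ∈ fed edge (n - r) n B) :
    feedDist edge n B ω ≤ r + feedDist edge (n - r) (Set.Iic n) ω := by
  refine hit_le_add_hit fun s hs => ?_
  have : n - (r + s : ℕ) = n - r - s := by push_cast; ring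
  rw [this]
  exact fed_trans (by omega) hs h

/-- A skeleton point of the graph on `(-∞, n - r]` remains one in the larger graph, since `n - r`
feeds everything to its right; draining looks only leftwards. -/
theorem skelDist_le {n : ℤ} {B : Set ℤ} {r : ℕ} {ω : Ω} (h : ω ∈ fed edge (n - r) (n - r) B) :
    skelDist edge n B ω ≤ r + skelDist edge (n - r) (Set.Iic (n - r)) ω := by
  refine hit_le_add_hit fun s hs => ?_
  have : n - (r + s : ℕ) = n - r - s := by push_cast; ring
  rw [this]
  exact ⟨fed_trans (by omega) hs.1 h, hs.2⟩

theorem feedDist_eq_zero {n : ℤ} {B : Set ℤ} {ω : Ω} (h : ω ∈ fed edge n n B) :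
    feedDist edge n B ω = 0 := by
  have : feedDist edge n B ω ≤ (0 : ℕ) := hit_le (by simpa using h)
  simpa using this

theorem skelDist_eq_zero {n : ℤ} {ω : Ω} (h : ω ∈ drained edge n) :
    skelDist edge n (Set.Iic n) ω = 0 := by
  have : skelDist edge n (Set.Iic n) ω ≤ (0 : ℕ) := by
    refine hit_le ⟨?_, by simpa using h⟩
    intro j hj hj'
    simp at hj hj'
    omega
  simpa using this

/-- Following incoming edges backwards from `j > n` without passing below `n` strictly decreases the
vertex, so it ends at `n`; draining is the mirror image. Conversely, the last or first edge of a
path is the required one. -/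
theorem mem_skeleton_iff {ω : Ω} {n : ℤ} :
    n ∈ skeleton edge ω ↔ ω ∈ fed edge n n Set.univ ∩ drained edge n := by
  constructor
  · rintro ⟨h1, h2⟩
    have key : ∀ a b, Leads edge ω a b → a < b := by
      intro a b hab
      induction hab with
      | single h => exact h.1
      | tail _ h ih => exact ih.trans h.1
    refine ⟨fun j _ hj => ?_, fun i hi => ?_⟩
    · obtain ⟨c, hc, hcj⟩ := (Relation.TransGen.tail'_iff).1 (h1 j hj)
      refine ⟨c, ?_, hcj.1, hcj.2⟩
      rcases Relation.reflTransGen_iff_eq_or_transGen.1 hc with h | h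
      · exact h.ge
      · exact (key _ _ h).le
    · obtain ⟨c, hc, hcj⟩ := (Relation.TransGen.head'_iff).1 (h2 i hi)
      refine ⟨c, hc.1, ?_, hc.2⟩
      rcases Relation.reflTransGen_iff_eq_or_transGen.1 hcj with h | h
      · exact h.ge
      · exact (key _ _ h).le
  · rintro ⟨h1, h2⟩
    constructor
    · have : ∀ k : ℕ, ∀ j, n < j → j ≤ n + k → Leads edge ω n j := by
        intro k
        induction k with
        | zero => intro j h h'; simp at h'; omega
        | succ k ih =>
          intro j h h'
          obtain ⟨i, hi, hij, he⟩ := h1 j trivial h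
          rcases hi.eq_or_lt with rfl | hlt
          · exact .single ⟨hij, he⟩
          · exact .tail (ih i hlt (by push_cast at h'; omega)) ⟨hij, he⟩
      exact fun j hj => this (j - n).toNat j hj (by omega)
    · have : ∀ k : ℕ, ∀ j, j < n → n ≤ j + k → Leads edge ω j n := by
        intro k
        induction k with
        | zero => intro j h h'; simp at h'; omega
        | succ k ih =>
          intro j h h'
          obtain ⟨i, hij, hi, he⟩ := h2 j h
          rcases hi.eq_or_lt with rfl | hlt
          · exact .single ⟨hij, he⟩
          · exact .head ⟨hij, he⟩ (ih i hlt (by push_cast at h'; omega))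
      exact fun j hj => this (n - j).toNat j hj (by omega)

theorem noOut_eq_reflect (i : ℤ) (l : ℕ) :
    noOut edge i l = noIn (fun i j => edge (-j) (-i)) (-i) l := by
  ext ω
  simp only [noIn, noOut, Set.mem_ofPred_eq, neg_neg]
  constructor
  · intro h j h1 h2
    exact h _ (by omega) (by omega)
  · intro h j h1 h2
    simpa using h (-j) (by omega) (by omega)

/-- The probability that a vertex has no incoming edge of length at most `l`. -/
noncomputable def tail (p : ℕ → ℝ) (l : ℕ) : ℝ≥0∞ :=
  ENNReal.ofReal (∏ i ∈ Finset.Icc 1 l, (1 - p i))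

theorem tail_zero (p : ℕ → ℝ) : tail p 0 = 1 := by simp [tail]

namespace IsLineModel

variable [mΩ : MeasurableSpace Ω] {P : Measure Ω} {p : ℕ → ℝ}

theorem edgeSigma_le (hG : IsLineModel p P edge) (S : Set (ℤ × ℤ)) : edgeSigma edge S ≤ mΩ := by
  refine MeasurableSpace.generateFrom_le ?_
  rintro t ⟨e, -, rfl⟩
  exact hG.measurableSet_edge _ _ e.2

theorem indep_edgeSigma (hG : IsLineModel p P edge) {S T : Set (ℤ × ℤ)}
    (h : ∀ i j, i < j → (i, j) ∈ S → (i, j) ∉ T) :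
    Indep (edgeSigma edge S) (edgeSigma edge T) P := by
  refine hG.indep.indep_generateFrom_of_disjoint
    (fun e => hG.measurableSet_edge _ _ e.2) _ _ ?_
  rw [Set.disjoint_left]
  intro e he
  exact h _ _ e.2 he

theorem measure_inter (hG : IsLineModel p P edge) {S T : Set (ℤ × ℤ)}
    (h : ∀ i j, i < j → (i, j) ∈ S → (i, j) ∉ T) {A B : Set Ω}
    (hA : MeasurableSet[edgeSigma edge S] A) (hB : MeasurableSet[edgeSigma edge T] B) :
    P (A ∩ B) = P A * P B :=
  (Indep_iff _ _ _).1 (hG.indep_edgeSigma h) A B hA hB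

/-- Reversing the orientation of the line gives the same model. -/
theorem reflect (hG : IsLineModel p P edge) : IsLineModel p P fun i j => edge (-j) (-i) where
  measurableSet_edge i j hij := hG.measurableSet_edge _ _ (by omega)
  indep := by
    let g : {e : ℤ × ℤ // e.1 < e.2} → {e : ℤ × ℤ // e.1 < e.2} :=
      fun e => ⟨(-e.1.2, -e.1.1), by have := e.2; simp only; omega⟩
    have hg : Function.Injective g := by
      rintro ⟨⟨a, b⟩, h⟩ ⟨⟨c, d⟩, h'⟩ hh
      simp only [g, Subtype.mk.injEq, Prod.mk.injEq, neg_inj] at hh ⊢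
      exact ⟨hh.2, hh.1⟩
    exact hG.indep.precomp hg
  prob_edge i j hij := by
    rw [hG.prob_edge _ _ (by omega)]
    congr 3
    ring

theorem measure_noIn [IsProbabilityMeasure P] (hG : IsLineModel p P edge)
    (hp : ∀ j : ℕ, 1 ≤ j → 0 ≤ p j ∧ p j < 1) (j : ℤ) (l : ℕ) :
    P (noIn edge j l) = tail p l := by
  induction l with
  | zero =>
    have : noIn edge j 0 = Set.univ := by
      ext ω
      simp only [noIn, Set.mem_ofPred_eq, Set.mem_univ, iff_true]
      intro i h h'
      simp at h
      omega
    rw [this, measure_univ, tail_zero]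
  | succ l ih =>
    have : noIn edge j (l + 1) = noIn edge j l ∩ (edge (j - (l + 1 : ℕ)) j)ᶜ := by
      ext ω
      simp only [noIn, Set.mem_inter_iff, Set.mem_ofPred_eq, Set.mem_compl_iff]
      constructor
      · intro h
        exact ⟨fun i hi => h i (by push_cast; omega), h _ le_rfl (by push_cast; omega)⟩
      · rintro ⟨h1, h2⟩ i hi hij
        rcases hi.eq_or_lt with rfl | hlt
        · exact h2
        · exact h1 i (by push_cast at hlt; omega) hij
    have hlt : j - (l + 1 : ℕ) < j := by push_cast; omega
    -- The edges into `j` of length at most `l` are separated from the one of length `l + 1` by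
    -- their starting points.
    rw [this, hG.measure_inter (S := {e | j - l ≤ e.1}) (T := {e | e.1 < j - l})
      (fun i k _ h h' => by simp at h h'; omega)
      (measurableSet_noIn fun i hi _ => hi)
      (measurableSet_edgeSigma hlt (by simp)).compl, ih,
      prob_compl_eq_one_sub (hG.measurableSet_edge _ _ hlt), hG.prob_edge _ _ hlt]
    have h1 : (j - (j - (l + 1 : ℕ))).toNat = l + 1 := by omega
    have hp1 := hp (l + 1) (by omega)
    rw [h1, tail, tail, Finset.prod_Icc_succ_top (by omega), ← ENNReal.ofReal_one,
      ← ENNReal.ofReal_sub _ hp1.1, ENNReal.ofReal_mul]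
    refine Finset.prod_nonneg fun i hi => ?_
    linarith [(hp i (Finset.mem_Icc.1 hi).1).2]

theorem measure_noOut [IsProbabilityMeasure P] (hG : IsLineModel p P edge)
    (hp : ∀ j : ℕ, 1 ≤ j → 0 ≤ p j ∧ p j < 1) (i : ℤ) (l : ℕ) :
    P (noOut edge i l) = tail p l := by
  rw [noOut_eq_reflect, hG.reflect.measure_noIn hp]

end IsLineModel

end EdgeEvents

/-! ### Summability consequences of [C3]. -/

section TailSums

theorem tsum_tsum_ite_lt (f : ℕ → ℝ≥0∞) :
    ∑' k, ∑' l : ℕ, (if l < k then f k else 0) = ∑' k : ℕ, k * f k := by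
  refine tsum_congr fun k => ?_
  rw [tsum_eq_sum (s := Finset.range k) fun l hl => if_neg (by simpa using hl),
    Finset.sum_congr rfl fun l hl => if_pos (Finset.mem_range.1 hl)]
  simp

/-- Each `k` is of the form `i + 1 + r` in exactly `k` ways. -/
theorem tsum_tsum_add_le (f : ℕ → ℝ≥0∞) :
    ∑' r, ∑' i, f (i + 1 + r) ≤ ∑' k : ℕ, k * f k := by
  rw [← tsum_tsum_ite_lt, ENNReal.tsum_comm (f := fun k l : ℕ => if l < k then f k else 0)]
  refine ENNReal.tsum_le_tsum fun r => ?_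
  calc ∑' i, f (i + 1 + r) = ∑' i, if r < i + 1 + r then f (i + 1 + r) else 0 :=
        tsum_congr fun i => (if_pos (by omega)).symm
    _ ≤ _ := ENNReal.tsum_comp_le_tsum_of_injective
        (f := fun i => i + 1 + r) (fun a b h => by simpa using h) fun k => if r < k then f k else 0

theorem tsum_tsum_max_le (f : ℕ → ℝ≥0∞) :
    ∑' k, ∑' l, f (max k l) ≤ 2 * ∑' k : ℕ, (k + 1) * f k := by
  have h1 : ∑' k, ∑' l : ℕ, (if l < k + 1 then f k else 0) = ∑' k : ℕ, (k + 1) * f k := by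
    refine tsum_congr fun k => ?_
    rw [tsum_eq_sum (s := Finset.range (k + 1)) fun l hl => if_neg (by simpa using hl),
      Finset.sum_congr rfl fun l hl => if_pos (Finset.mem_range.1 hl)]
    simp
  calc ∑' k, ∑' l, f (max k l)
      ≤ ∑' k, ∑' l : ℕ, ((if l < k + 1 then f k else 0) + if k < l + 1 then f l else 0) := by
        refine ENNReal.tsum_le_tsum fun k => ENNReal.tsum_le_tsum fun l => ?_
        rcases le_total k l with h | h
        · rw [max_eq_right h, if_pos (show k < l + 1 by omega)]; exact le_add_self
        · rw [max_eq_left h, if_pos (show l < k + 1 by omega)]; exact le_self_add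
    _ = 2 * ∑' k : ℕ, (k + 1) * f k := by
        simp_rw [ENNReal.tsum_add]
        rw [ENNReal.tsum_comm (f := fun k l => if k < l + 1 then f l else 0), h1, two_mul]

theorem tsum_tail_ne_top {p : ℕ → ℝ} (h : ∑' k : ℕ, k * tail p k ≠ ∞) : ∑' k, tail p k ≠ ∞ := by
  -- The weight `k` vanishes at `k = 0`, so that term is split off before comparing.
  rw [tsum_eq_zero_add' ENNReal.summable, tail_zero]
  refine ENNReal.add_ne_top.2 ⟨ENNReal.one_ne_top, ne_top_of_le_ne_top h ?_⟩
  calc ∑' k, tail p (k + 1) ≤ ∑' k : ℕ, ((k + 1 : ℕ) : ℝ≥0∞) * tail p (k + 1) :=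
        ENNReal.tsum_le_tsum fun k => le_mul_of_one_le_left' (by exact_mod_cast Nat.le_add_left 1 k)
    _ ≤ ∑' k : ℕ, k * tail p k := ENNReal.tsum_comp_le_tsum_of_injective
        (f := fun k => k + 1) (fun a b h => by simpa using h) fun k : ℕ => (k : ℝ≥0∞) * tail p k

/-- A bound for the sum over `k` of the expected reach of the edges out of the `k` vertices
preceding a vertex, on the event that the next vertex has no edge into these. -/
theorem tsum_tail_max_mul_tail_ne_top {p : ℕ → ℝ} (h : ∑' k : ℕ, k * tail p k ≠ ∞) :
    ∑' k, ∑' r, ∑' i, tail p (max k (i + 1 + r)) * tail p i ≠ ∞ := by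
  have h0 := tsum_tail_ne_top h
  have hb : (∑' k, ∑' l, tail p (max k l)) ≠ ∞ := by
    refine ne_top_of_le_ne_top ?_ (tsum_tsum_max_le _)
    refine ENNReal.mul_ne_top (by simp) ?_
    simp_rw [add_mul, one_mul]
    rw [ENNReal.tsum_add]
    exact ENNReal.add_ne_top.2 ⟨h, h0⟩
  refine ne_top_of_le_ne_top (ENNReal.mul_ne_top hb h0) ?_
  calc ∑' k, ∑' r, ∑' i, tail p (max k (i + 1 + r)) * tail p i
      = ∑' k, ∑' i, (∑' r, tail p (max k (i + 1 + r))) * tail p i := by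
        refine tsum_congr fun k => ?_
        rw [ENNReal.tsum_comm]
        exact tsum_congr fun i => ENNReal.tsum_mul_right
    _ ≤ ∑' k, ∑' i, (∑' l, tail p (max k l)) * tail p i := by
        refine ENNReal.tsum_le_tsum fun k => ENNReal.tsum_le_tsum fun i => ?_
        refine mul_le_mul' ?_ le_rfl
        exact ENNReal.tsum_comp_le_tsum_of_injective (f := fun r => i + 1 + r)
          (fun a b h => by simpa using h) fun l => tail p (max k l)
    _ = _ := by simp_rw [ENNReal.tsum_mul_left, ENNReal.tsum_mul_right]

theorem condC3_iff {p : ℕ → ℝ} (hp : ∀ j : ℕ, 1 ≤ j → 0 ≤ p j ∧ p j < 1) :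
    CondC3 p ↔ ∑' k : ℕ, k * tail p k ≠ ∞ := by
  have hnn : ∀ k : ℕ, 0 ≤ ∏ i ∈ Finset.Icc 1 k, (1 - p i) := fun k =>
    Finset.prod_nonneg fun i hi => by linarith [(hp i (Finset.mem_Icc.1 hi).1).2]
  have : ∀ k : ℕ, (k : ℝ≥0∞) * tail p k =
      ENNReal.ofReal ((k : ℝ) * ∏ i ∈ Finset.Icc 1 k, (1 - p i)) := fun k => by
    rw [ENNReal.ofReal_mul (by positivity), ENNReal.ofReal_natCast, tail]
  simp_rw [this, CondC3]
  constructor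
  · exact fun h => h.tsum_ofReal_ne_top
  · intro h
    have := ENNReal.summable_toReal h
    refine this.congr fun k => ?_
    rw [ENNReal.toReal_ofReal (mul_nonneg (by positivity) (hnn k))]

end TailSums

/-! ### The second moment of `ξ`. -/

section SecondMoment

/-- A square is a sum of consecutive odd numbers; integrating turns this into a sum over the tails
of `ξ`. -/
theorem natCast_sq_eq_tsum (x : ℕ∞) :
    ((x : ℕ∞) : ℝ≥0∞) ^ 2 = ∑' l : ℕ, if (l : ℕ∞) < x then (2 * l + 1 : ℝ≥0∞) else 0 := by
  induction x using ENat.recTopCoe with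
  | top =>
    have h1 : ∀ l : ℕ, (l : ℕ∞) < ⊤ := fun l => ENat.natCast_lt_top l
    simp only [ENat.toENNReal_top, h1, if_true]
    symm
    refine top_unique ?_
    calc (⊤ : ℝ≥0∞) ^ 2 = ⊤ := by simp
      _ = ∑' _ : ℕ, (1 : ℝ≥0∞) := by simp
      _ ≤ _ := ENNReal.tsum_le_tsum fun l => le_add_self
  | coe n =>
    rw [tsum_eq_sum (s := Finset.range n) fun l hl =>
      if_neg (by simpa using hl),
      Finset.sum_congr rfl fun l hl => if_pos (by simpa using hl)]
    have : ∀ n : ℕ, ∑ l ∈ Finset.range n, (2 * l + 1) = n ^ 2 := by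
      intro n
      induction n with
      | zero => simp
      | succ n ih => rw [Finset.sum_range_succ, ih]; ring
    simp only [ENat.toENNReal_coe]
    exact_mod_cast (this n).symm

variable {Ω : Type*} {edge : ℤ → ℤ → Set Ω}

theorem lt_xi_iff {j : ℤ} {l : ℕ} {ω : Ω} : (l : ℕ∞) < xi edge j ω ↔ ω ∈ noIn edge j l := by
  rw [← not_le, not_iff_comm]
  constructor
  · intro h
    simp only [noIn, Set.mem_ofPred_eq, not_forall, not_not] at h
    obtain ⟨i, hi, hij, he⟩ := h
    have hk : ((j - i).toNat : ℤ) = j - i := by omega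
    have hle : xi edge j ω ≤ ((j - i).toNat : ℕ∞) :=
      iInf₂_le (j - i).toNat ⟨by omega, by rw [hk]; simpa using he⟩
    exact hle.trans (by exact_mod_cast (by omega : (j - i).toNat ≤ l))
  · intro h hn
    have : ((l + 1 : ℕ) : ℕ∞) ≤ xi edge j ω := by
      refine le_iInf₂ fun k hk => ?_
      by_contra hlt
      have hlt : k < l + 1 := by exact_mod_cast not_le.1 hlt
      exact hn _ (by omega) (by omega) hk.2
    have h2 : l + 1 ≤ l := by exact_mod_cast this.trans h
    omega

theorem IsLineModel.lintegral_xi_sq [MeasurableSpace Ω] {P : Measure Ω} [IsProbabilityMeasure P]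
    {p : ℕ → ℝ} (hG : IsLineModel p P edge) (hp : ∀ j : ℕ, 1 ≤ j → 0 ≤ p j ∧ p j < 1) (j : ℤ) :
    ∫⁻ ω, ((xi edge j ω : ℕ∞) : ℝ≥0∞) ^ 2 ∂P = ∑' l : ℕ, (2 * l + 1) * tail p l := by
  classical
  have hm : ∀ l, MeasurableSet (noIn edge j l) := fun l =>
    hG.edgeSigma_le Set.univ _ (measurableSet_noIn fun _ _ _ => trivial)
  have : ∀ ω, ((xi edge j ω : ℕ∞) : ℝ≥0∞) ^ 2 =
      ∑' l : ℕ, (noIn edge j l).indicator (fun _ => (2 * l + 1 : ℝ≥0∞)) ω := by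
    intro ω
    rw [natCast_sq_eq_tsum]
    refine tsum_congr fun l => ?_
    simp only [lt_xi_iff, Set.indicator_apply]
  rw [lintegral_congr this,
    lintegral_tsum fun l => (measurable_const.indicator (hm l)).aemeasurable]
  refine tsum_congr fun l => ?_
  rw [lintegral_indicator_const (hm l), hG.measure_noIn hp]

theorem IsLineModel.condC3_iff_lintegral_xi_sq_lt_top [MeasurableSpace Ω] {P : Measure Ω}
    [IsProbabilityMeasure P] {p : ℕ → ℝ} (hG : IsLineModel p P edge)
    (hp : ∀ j : ℕ, 1 ≤ j → 0 ≤ p j ∧ p j < 1) (j : ℤ) :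
    CondC3 p ↔ ∫⁻ ω, ((xi edge j ω : ℕ∞) : ℝ≥0∞) ^ 2 ∂P < ∞ := by
  rw [hG.lintegral_xi_sq hp, condC3_iff hp, lt_top_iff_ne_top]
  simp_rw [add_mul, one_mul, mul_assoc]
  rw [ENNReal.tsum_add, ENNReal.tsum_mul_left]
  constructor
  · exact fun h => ENNReal.add_ne_top.2 ⟨ENNReal.mul_ne_top (by simp) h, tsum_tail_ne_top h⟩
  · intro h
    refine ne_top_of_le_ne_top (ENNReal.add_ne_top.1 h).1 ?_
    exact le_mul_of_one_le_left' (by norm_num)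

end SecondMoment

/-! ### Renewal estimates for feeding and skeleton distances. -/

section Renewal

variable {Ω : Type*} {edge : ℤ → ℤ → Set Ω}

theorem compl_fed_subset (n : ℤ) (r : ℕ) (B : Set ℤ) :
    (fed edge (n - r) n B)ᶜ ⊆ ⋃ i : ℕ, {_ω | n + 1 + i ∈ B} ∩ noIn edge (n + 1 + i) (i + 1 + r) := by
  intro ω hω
  simp only [fed, Set.mem_compl_iff, Set.mem_ofPred_eq, not_forall] at hω
  obtain ⟨j, hj, hnj, h⟩ := hω
  refine Set.mem_iUnion.2 ⟨(j - n - 1).toNat, ?_⟩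
  have hk : n + 1 + ((j - n - 1).toNat : ℤ) = j := by omega
  rw [hk]
  exact ⟨hj, fun i hi hij he => h ⟨i, by omega, hij, he⟩⟩

theorem compl_drained (n : ℤ) :
    (drained edge n)ᶜ = ⋃ k : ℕ, noOut edge (n - (k + 1 : ℕ)) (k + 1) := by
  ext ω
  simp only [drained, noOut, Set.mem_compl_iff, Set.mem_ofPred_eq, not_forall, Set.mem_iUnion]
  constructor
  · rintro ⟨i, hi, h⟩
    have hk : n - (((n - i - 1).toNat + 1 : ℕ) : ℤ) = i := by omega
    refine ⟨(n - i - 1).toNat, ?_⟩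
    rw [hk]
    exact fun j hij hj he => h ⟨j, hij, by omega, he⟩
  · rintro ⟨k, h⟩
    exact ⟨n - (k + 1 : ℕ), by omega, fun ⟨j, hij, hj, he⟩ => h j hij (by omega) he⟩

theorem drained_eq_reflect (n : ℤ) :
    drained edge n = fed (fun i j => edge (-j) (-i)) (-n) (-n) Set.univ := by
  ext ω
  simp only [fed, drained, Set.mem_ofPred_eq, Set.mem_univ, true_imp_iff]
  constructor
  · intro h j hj
    obtain ⟨k, h1, h2, h3⟩ := h (-j) (by omega)
    exact ⟨-k, by omega, by omega, by simpa using h3⟩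
  · intro h i hi
    obtain ⟨k, h1, h2, h3⟩ := h (-i) (by omega)
    exact ⟨-k, by omega, by omega, by simpa using h3⟩

namespace IsLineModel

variable [mΩ : MeasurableSpace Ω] {P : Measure Ω} {p : ℕ → ℝ}

theorem measurableSet_fed' (hG : IsLineModel p P edge) (n m : ℤ) (B : Set ℤ) :
    MeasurableSet (fed edge n m B) :=
  hG.edgeSigma_le Set.univ _ (measurableSet_fed fun _ _ _ _ _ _ => trivial)

theorem measurableSet_drained' (hG : IsLineModel p P edge) (n : ℤ) :
    MeasurableSet (drained edge n) :=
  hG.edgeSigma_le Set.univ _ (measurableSet_drained fun _ _ _ _ => trivial)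

theorem setLIntegral_reach_le (hG : IsLineModel p P edge) (n : ℤ) (B : Set ℤ) (G : Set Ω) :
    ∫⁻ ω in G, reach edge n B ω ∂P ≤
      ∑' (r : ℕ) (i : ℕ), P (G ∩ ({_ω | n + 1 + i ∈ B} ∩ noIn edge (n + 1 + i) (i + 1 + r))) := by
  refine (setLIntegral_hit_le fun r => hG.measurableSet_fed' _ _ _).trans ?_
  refine ENNReal.tsum_le_tsum fun r => ?_
  refine (measure_mono (Set.inter_subset_inter_right G (compl_fed_subset n r B))).trans ?_
  rw [Set.inter_iUnion]
  exact measure_iUnion_le _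

variable [IsProbabilityMeasure P]

/-- The `N` consecutive edges of length 1 starting at `n` suffice. -/
theorem pow_le_measure_fed_Iic (hG : IsLineModel p P edge) (n : ℤ) (N : ℕ) :
    ENNReal.ofReal (p 1) ^ N ≤ P (fed edge n n (Set.Iic (n + N))) := by
  induction N with
  | zero =>
    have : fed edge n n (Set.Iic (n + (0 : ℕ))) = Set.univ := by
      ext ω
      simp only [fed, Set.mem_ofPred_eq, Set.mem_univ, iff_true]
      intro j hj hj'
      simp at hj
      omega
    rw [this]; simp
  | succ N ih =>
    have hlt : n + (N : ℤ) < n + N + 1 := by omega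
    have hsub : fed edge n n (Set.Iic (n + N)) ∩ edge (n + N) (n + N + 1) ⊆
        fed edge n n (Set.Iic (n + (N + 1 : ℕ))) := by
      rintro ω ⟨h, he⟩
      refine fed_trans le_rfl h fun j hj hj' => ⟨n + N, by omega, hj', ?_⟩
      have hj2 : j ≤ n + (N + 1 : ℕ) := hj
      have : j = n + N + 1 := by push_cast at hj2; omega
      rwa [this]
    refine le_trans ?_ (measure_mono hsub)
    rw [hG.measure_inter (S := {e | e.2 ≤ n + N}) (T := {e | n + N < e.2})
      (fun i j _ h h' => by simp at h h'; omega)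
      (measurableSet_fed fun i j _ _ _ hj => hj)
      (measurableSet_edgeSigma hlt (by simp)), hG.prob_edge _ _ hlt, pow_succ]
    have h1 : (n + N + 1 - (n + N) : ℤ).toNat = 1 := by omega
    rw [h1]
    gcongr

theorem measure_compl_fed_le (hG : IsLineModel p P edge)
    (hp : ∀ j : ℕ, 1 ≤ j → 0 ≤ p j ∧ p j < 1) (n : ℤ) (r : ℕ) (B : Set ℤ) :
    P (fed edge (n - r) n B)ᶜ ≤ ∑' i, tail p (i + 1 + r) := by
  refine (measure_mono (compl_fed_subset n r B)).trans ((measure_iUnion_le _).trans ?_)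
  refine ENNReal.tsum_le_tsum fun i => ?_
  rw [← hG.measure_noIn hp (n + 1 + i) (i + 1 + r)]
  exact measure_mono Set.inter_subset_right

/-- The first `N` vertices are fed by unit edges, the later ones by edges that fail with total
probability at most 1/2; the two families are disjoint. -/
theorem le_measure_fed (hG : IsLineModel p P edge) (hp : ∀ j : ℕ, 1 ≤ j → 0 ≤ p j ∧ p j < 1)
    {N : ℕ} (hN : ∑' i, tail p (i + 1 + N) ≤ 2⁻¹) (n : ℤ) (B : Set ℤ) :
    ENNReal.ofReal (p 1) ^ N * 2⁻¹ ≤ P (fed edge n n B) := by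
  have hsub : fed edge n n (Set.Iic (n + N)) ∩ fed edge n (n + N) Set.univ ⊆ fed edge n n B :=
    fun ω h j _ hj => fed_trans le_rfl h.1 h.2 j trivial hj
  refine le_trans ?_ (measure_mono hsub)
  rw [hG.measure_inter (S := {e | e.2 ≤ n + N}) (T := {e | n + N < e.2})
    (fun i j _ h h' => by simp at h h'; omega)
    (measurableSet_fed fun i j _ _ _ hj => hj)
    (measurableSet_fed fun i j _ _ hj _ => hj)]
  refine mul_le_mul' (hG.pow_le_measure_fed_Iic n N) ?_
  have h1 := hG.measure_compl_fed_le hp (n + N) N Set.univ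
  rw [add_sub_cancel_right, prob_compl_eq_one_sub (hG.measurableSet_fed' _ _ _)] at h1
  have h2 := h1.trans hN
  rw [tsub_le_iff_left, ← tsub_le_iff_right, ENNReal.one_sub_inv_two] at h2
  exact h2

/-- The probability that a vertex is fed, or drained, is bounded away from zero. -/
theorem exists_pos_le_measure (hG : IsLineModel p P edge)
    (hp : ∀ j : ℕ, 1 ≤ j → 0 ≤ p j ∧ p j < 1) (h1 : 0 < p 1)
    (h3 : ∑' k : ℕ, k * tail p k ≠ ∞) :
    ∃ c : ℝ≥0∞, c ≠ 0 ∧ c ≤ 1 ∧ (∀ n B, c ≤ P (fed edge n n B)) ∧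
      ∀ n, c ≤ P (drained edge n) := by
  have ht := ENNReal.tendsto_sum_nat_add _ (tsum_tail_ne_top h3)
  obtain ⟨N, hN⟩ := ((ht.comp (Filter.tendsto_add_atTop_nat 1)).eventually
    (gt_mem_nhds (by simp : (0 : ℝ≥0∞) < 2⁻¹))).exists
  have hN' : ∑' i, tail p (i + 1 + N) ≤ 2⁻¹ := by
    refine le_trans (le_of_eq ?_) hN.le
    exact tsum_congr fun i => by congr 1; ring
  have hf := hG.le_measure_fed hp hN'
  refine ⟨ENNReal.ofReal (p 1) ^ N * 2⁻¹, ?_, (hf 0 Set.univ).trans prob_le_one, hf, fun n => ?_⟩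
  · simp [h1]
  · rw [drained_eq_reflect]
    exact hG.reflect.le_measure_fed hp hN' _ _

theorem lintegral_reach_le (hG : IsLineModel p P edge)
    (hp : ∀ j : ℕ, 1 ≤ j → 0 ≤ p j ∧ p j < 1) (n : ℤ) (B : Set ℤ) (G : Set Ω) :
    ∫⁻ ω in G, reach edge n B ω ∂P ≤ ∑' k : ℕ, k * tail p k := by
  refine (hG.setLIntegral_reach_le n B G).trans (le_trans ?_ (tsum_tsum_add_le _))
  refine ENNReal.tsum_le_tsum fun r => ENNReal.tsum_le_tsum fun i => ?_
  rw [← hG.measure_noIn hp (n + 1 + i) (i + 1 + r)]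
  exact measure_mono (Set.inter_subset_right.trans Set.inter_subset_right)

/-- The two events share the edge from `n` to `n + 1 + i`, so they do not factor. Shortening one of
them to range `i` discards the shared edge; the event with the longer range is kept whole, which
produces the maximum. -/
theorem measure_noOut_inter_noIn_le (hG : IsLineModel p P edge)
    (hp : ∀ j : ℕ, 1 ≤ j → 0 ≤ p j ∧ p j < 1) (n : ℤ) {k i : ℕ} (hik : i < k) (r : ℕ) :
    P (noOut edge n k ∩ noIn edge (n + 1 + i) (i + 1 + r)) ≤
      tail p (max k (i + 1 + r)) * tail p i := by
  rcases le_total (i + 1 + r) k with h | h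
  · have hsub : noOut edge n k ∩ noIn edge (n + 1 + i) (i + 1 + r) ⊆
        noOut edge n k ∩ noIn edge (n + 1 + i) i :=
      Set.inter_subset_inter_right _ fun ω hω i' h1 h2 => hω i' (by push_cast; omega) h2
    refine (measure_mono hsub).trans ?_
    rw [hG.measure_inter (S := {e | e.1 = n}) (T := {e | n < e.1})
      (fun i j _ h h' => by simp at h h'; omega) (measurableSet_noOut fun _ _ _ => rfl)
      (measurableSet_noIn fun i h _ => by simp at h ⊢; linarith), hG.measure_noOut hp,
      hG.measure_noIn hp, max_eq_left h]
  · have hsub : noOut edge n k ∩ noIn edge (n + 1 + i) (i + 1 + r) ⊆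
        noOut edge n i ∩ noIn edge (n + 1 + i) (i + 1 + r) :=
      Set.inter_subset_inter_left _ fun ω hω j h1 h2 => hω j h1 (by omega)
    refine (measure_mono hsub).trans ?_
    rw [hG.measure_inter (S := {e | e.2 ≤ n + i}) (T := {e | n + i < e.2})
      (fun i j _ h h' => by simp at h h'; omega) (measurableSet_noOut fun _ _ h => h)
      (measurableSet_noIn fun i h _ => by simp), hG.measure_noOut hp,
      hG.measure_noIn hp, max_eq_right h, mul_comm]

theorem tsum_setLIntegral_noOut_reach_le (hG : IsLineModel p P edge)
    (hp : ∀ j : ℕ, 1 ≤ j → 0 ≤ p j ∧ p j < 1) (n : ℤ) :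
    ∑' k : ℕ, ∫⁻ ω in noOut edge (n - k) k, reach edge (n - k) (Set.Iic n) ω ∂P ≤
      ∑' k, ∑' r, ∑' i, tail p (max k (i + 1 + r)) * tail p i := by
  refine ENNReal.tsum_le_tsum fun k => (hG.setLIntegral_reach_le _ _ _).trans ?_
  refine ENNReal.tsum_le_tsum fun r => ENNReal.tsum_le_tsum fun i => ?_
  -- Only the `k` vertices of `(n - k, n]` have to be fed.
  by_cases hik : i < k
  · refine le_trans (measure_mono ?_) (hG.measure_noOut_inter_noIn_le hp (n - k) hik r)
    exact Set.inter_subset_inter_right _ Set.inter_subset_right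
  · have : {ω : Ω | n - k + 1 + i ∈ Set.Iic n} = ∅ := by
      ext ω
      simp
      omega
    rw [this]
    simp

theorem lintegral_feedDist_le (hG : IsLineModel p P edge)
    (hp : ∀ j : ℕ, 1 ≤ j → 0 ≤ p j ∧ p j < 1) {c : ℝ≥0∞} (hc : c ≠ 0) (hc1 : c ≤ 1)
    (hfed : ∀ n B, c ≤ P (fed edge n n B)) (n : ℤ) (B : Set ℤ) :
    ∫⁻ ω, feedDist edge n B ω ∂P ≤ (∑' k : ℕ, k * tail p k) / c := by
  refine lintegral_le_of_forall_min_le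
    ((measurable_feedDist (S := Set.univ) fun _ _ _ _ => trivial).mono
      (hG.edgeSigma_le _) le_rfl) fun K => ?_
  set s : ℝ≥0∞ := ⨆ (n : ℤ) (B : Set ℤ), ∫⁻ ω, min (feedDist edge n B ω) K ∂P
  have hle : ∀ n B, ∫⁻ ω, min (feedDist edge n B ω) K ∂P ≤ s := fun n B =>
    le_iSup₂ (f := fun (n : ℤ) (B : Set ℤ) => ∫⁻ ω, min (feedDist edge n B ω) K ∂P) n B
  refine (hle n B).trans (le_div_of_le_add_one_sub_mul ?_ hc hc1 (iSup₂_le fun n B => ?_))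
  · refine ne_top_of_le_ne_top (ENNReal.natCast_ne_top K) (iSup₂_le fun n B => ?_)
    calc ∫⁻ ω, min (feedDist edge n B ω) K ∂P ≤ ∫⁻ _, (K : ℝ≥0∞) ∂P :=
          lintegral_mono fun ω => min_le_right _ _
      _ = K := by simp
  · have hGm := (hG.measurableSet_fed' n n B).compl
    rw [lintegral_eq_setLIntegral_of_eq_zero hGm fun ω hω => by
      rw [feedDist_eq_zero (not_not.1 hω)]; simp]
    have hfr : ∀ r : ℕ, MeasurableSet[edgeSigma edge {e | n < e.2}] (fed edge (n - r) n B) :=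
      fun r => measurableSet_fed fun i j _ _ h _ => h
    refine (setLIntegral_le_of_regeneration (A := fun r : ℕ => fed edge (n - r) n B) (c := 0)
      (U := fun r ω => min (feedDist edge (n - r) (Set.Iic n) ω) K) (K := s)
      (fun _ => edgeSigma edge {e | n < e.2}) (fun _ => edgeSigma edge {e | e.2 ≤ n})
      (fun _ => hG.edgeSigma_le _) (fun _ => hG.edgeSigma_le _)
      (fun _ => hG.indep_edgeSigma fun i j _ h h' => by simp at h h'; omega)
      (fun _ => (measurableSet_fed fun i j _ _ h _ => h).compl)
      (fun r => MeasurableSet.disjointed hfr r)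
      (fun r => hG.measurableSet_fed' _ _ _)
      (fun r => Measurable.min (measurable_feedDist fun i j _ h => h) measurable_const)
      (fun r => hle _ _) fun r ω _ hr => ?_).trans ?_
    · rw [zero_add]
      exact (min_le_min (feedDist_le (mem_disjointed_iff.1 hr).1) le_rfl).trans
        (min_add_le_add_min _ _ _)
    · rw [zero_mul, zero_add]
      refine add_le_add (hG.lintegral_reach_le hp n B _) (mul_le_mul' ?_ le_rfl)
      rw [prob_compl_eq_one_sub (hG.measurableSet_fed' _ _ _)]
      exact tsub_le_tsub_left (hfed n B) 1

/-- Edges out of `n` end to the right of `n`, so `noOut` belongs to the edges revealed in the first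
feeding step and is independent of the remainder. -/
theorem setLIntegral_noOut_feedDist_le (hG : IsLineModel p P edge)
    (hp : ∀ j : ℕ, 1 ≤ j → 0 ≤ p j ∧ p j < 1) {C : ℝ≥0∞}
    (hC : ∀ n B, ∫⁻ ω, feedDist edge n B ω ∂P ≤ C) (n : ℤ) (k : ℕ) (B : Set ℤ) :
    ∫⁻ ω in noOut edge n k, feedDist edge n B ω ∂P ≤
      ∫⁻ ω in noOut edge n k, reach edge n B ω ∂P + tail p k * C := by
  have hfr : ∀ r : ℕ, MeasurableSet[edgeSigma edge {e | n < e.2}] (fed edge (n - r) n B) :=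
    fun r => measurableSet_fed fun i j _ _ h _ => h
  refine (setLIntegral_le_of_regeneration (A := fun r : ℕ => fed edge (n - r) n B) (c := 0)
    (U := fun r ω => feedDist edge (n - r) (Set.Iic n) ω) (K := C)
    (fun _ => edgeSigma edge {e | n < e.2}) (fun _ => edgeSigma edge {e | e.2 ≤ n})
    (fun _ => hG.edgeSigma_le _) (fun _ => hG.edgeSigma_le _)
    (fun _ => hG.indep_edgeSigma fun i j _ h h' => by simp at h h'; omega)
    (fun _ => measurableSet_noOut fun j h _ => h)
    (fun r => MeasurableSet.disjointed hfr r)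
    (fun r => hG.measurableSet_fed' _ _ _)
    (fun r => measurable_feedDist fun i j _ h => h)
    (fun r => hC _ _) fun r ω _ hr => ?_).trans ?_
  · rw [zero_add]
    exact feedDist_le (mem_disjointed_iff.1 hr).1
  · rw [zero_mul, zero_add, hG.measure_noOut hp]
    rfl

/-- The expected distance to the closest skeleton point on the left, in the graph restricted to a
left half-line, is bounded uniformly in the half-line. -/
theorem lintegral_skelDist_le (hG : IsLineModel p P edge)
    (hp : ∀ j : ℕ, 1 ≤ j → 0 ≤ p j ∧ p j < 1) {c C : ℝ≥0∞} (hc : c ≠ 0) (hc1 : c ≤ 1)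
    (hdrained : ∀ n, c ≤ P (drained edge n))
    (hC : ∀ n B, ∫⁻ ω, feedDist edge n B ω ∂P ≤ C) (n : ℤ) :
    ∫⁻ ω, skelDist edge n (Set.Iic n) ω ∂P ≤
      (∑' k : ℕ, k * tail p k + (∑' k, ∑' r, ∑' i, tail p (max k (i + 1 + r)) * tail p i +
        (∑' k, tail p k) * C)) / c := by
  refine lintegral_le_of_forall_min_le
    ((measurable_skelDist (S := Set.univ) fun _ _ _ _ => trivial).mono
      (hG.edgeSigma_le _) le_rfl) fun K => ?_
  set s : ℝ≥0∞ := ⨆ n : ℤ, ∫⁻ ω, min (skelDist edge n (Set.Iic n) ω) K ∂P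
  have hle : ∀ n, ∫⁻ ω, min (skelDist edge n (Set.Iic n) ω) K ∂P ≤ s := fun n =>
    le_iSup (f := fun n : ℤ => ∫⁻ ω, min (skelDist edge n (Set.Iic n) ω) K ∂P) n
  refine (hle n).trans (le_div_of_le_add_one_sub_mul ?_ hc hc1 (iSup_le fun n => ?_))
  · refine ne_top_of_le_ne_top (ENNReal.natCast_ne_top K) (iSup_le fun n => ?_)
    calc ∫⁻ ω, min (skelDist edge n (Set.Iic n) ω) K ∂P ≤ ∫⁻ _, (K : ℝ≥0∞) ∂P :=
          lintegral_mono fun ω => min_le_right _ _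
      _ = K := by simp
  have hGm := (hG.measurableSet_drained' n).compl
  rw [lintegral_eq_setLIntegral_of_eq_zero hGm fun ω hω => by
    rw [skelDist_eq_zero (not_not.1 hω)]; simp]
  -- `F k` says that `n - (k + 1)` is the vertex closest to `n` that violates draining; it depends
  -- only on edges inside `[n - (k + 1), n]`.
  let F : ℕ → Set Ω := disjointed fun k : ℕ => noOut edge (n - (k + 1 : ℕ)) (k + 1)
  have hF : (drained edge n)ᶜ = ⋃ k, F k := by rw [iUnion_disjointed, compl_drained]
  have hFsub : ∀ k, F k ⊆ noOut edge (n - (k + 1 : ℕ)) (k + 1) := fun k => disjointed_subset _ k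
  have hFm : ∀ k, MeasurableSet[edgeSigma edge {e | n - (k + 1 : ℕ) ≤ e.1 ∧ e.2 ≤ n}] (F k) := by
    refine fun k => measurableSet_disjointed fun l hl => measurableSet_noOut fun j _ h => ⟨?_, ?_⟩
    · simp only; omega
    · simp only; omega
  have hFm' : ∀ k, MeasurableSet (F k) := fun k => hG.edgeSigma_le _ _ (hFm k)
  have hstep : ∀ k : ℕ, ∫⁻ ω in F k, min (skelDist edge n (Set.Iic n) ω) K ∂P ≤
      ((k + 1 : ℕ) * tail p (k + 1) +
        (∫⁻ ω in noOut edge (n - (k + 1 : ℕ)) (k + 1),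
          reach edge (n - (k + 1 : ℕ)) (Set.Iic n) ω ∂P + tail p (k + 1) * C)) + P (F k) * s := by
    intro k
    -- Stopping at the first feeding vertex uses no edge starting to its left, so the edges ending
    -- at or before it are still fresh.
    have hAm : ∀ t : ℕ, MeasurableSet[edgeSigma edge {e | n - (k + 1 : ℕ) - t ≤ e.1 ∧ e.2 ≤ n}]
        (disjointed (fun t : ℕ => fed edge (n - (k + 1 : ℕ) - t) (n - (k + 1 : ℕ) - t)
          (Set.Iic n)) t) := by
      refine fun t => measurableSet_disjointed fun l hl =>
        measurableSet_fed fun i j _ h _ h' => ⟨?_, h'⟩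
      simp only; omega
    refine (setLIntegral_le_of_regeneration
      (A := fun t : ℕ => fed edge (n - (k + 1 : ℕ) - t) (n - (k + 1 : ℕ) - t) (Set.Iic n))
      (c := (k + 1 : ℕ)) (K := s)
      (U := fun t ω => min (skelDist edge (n - (k + 1 : ℕ) - t)
        (Set.Iic (n - (k + 1 : ℕ) - t)) ω) K)
      (fun t => edgeSigma edge {e | n - (k + 1 : ℕ) - t ≤ e.1 ∧ e.2 ≤ n})
      (fun t => edgeSigma edge {e | e.2 ≤ n - (k + 1 : ℕ) - t})
      (fun _ => hG.edgeSigma_le _) (fun _ => hG.edgeSigma_le _)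
      (fun t => hG.indep_edgeSigma fun i j hij h h' => by
        have h1 := h.1
        have h2 : j ≤ n - (k + 1 : ℕ) - t := h'
        simp only at h1
        omega)
      (fun t => edgeSigma_mono (S := {e | n - (k + 1 : ℕ) ≤ e.1 ∧ e.2 ≤ n})
        (S' := {e | n - (k + 1 : ℕ) - t ≤ e.1 ∧ e.2 ≤ n})
        (fun i j _ h => ⟨by have h1 := h.1; simp only at h1 ⊢; omega, h.2⟩) _ (hFm k))
      hAm (fun t => hG.measurableSet_fed' _ _ _)
      (fun t => Measurable.min (measurable_skelDist fun i j _ h => h.elim id id) measurable_const)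
      (fun t => hle _) fun t ω _ ht => ?_).trans ?_
    · have hmem := (mem_disjointed_iff.1 ht).1
      have hcast : n - (k + 1 : ℕ) - (t : ℤ) = n - (k + 1 + t : ℕ) := by push_cast; ring
      rw [hcast] at hmem ⊢
      refine ((min_le_min (skelDist_le hmem) le_rfl).trans (min_add_le_add_min _ _ _)).trans ?_
      rw [Nat.cast_add (k + 1) t]
    · refine add_le_add (add_le_add ?_ ?_) le_rfl
      · refine mul_le_mul' le_rfl ?_
        rw [← hG.measure_noOut hp (n - (k + 1 : ℕ)) (k + 1)]
        exact measure_mono (hFsub k)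
      · refine (lintegral_mono_set (hFsub k)).trans ?_
        exact hG.setLIntegral_noOut_feedDist_le hp hC _ _ _
  have hshift : ∀ f : ℕ → ℝ≥0∞, ∑' k, f (k + 1) ≤ ∑' k, f k := fun f =>
    ENNReal.tsum_comp_le_tsum_of_injective (f := fun k => k + 1)
      (fun a b h => by simpa using h) f
  calc ∫⁻ ω in (drained edge n)ᶜ, min (skelDist edge n (Set.Iic n) ω) K ∂P
      ≤ ∑' k, ∫⁻ ω in F k, min (skelDist edge n (Set.Iic n) ω) K ∂P := by
        rw [hF]; exact lintegral_iUnion_le _ _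
    _ ≤ _ := ENNReal.tsum_le_tsum hstep
    _ ≤ _ := by
        rw [ENNReal.tsum_add, ENNReal.tsum_add, ENNReal.tsum_add, ENNReal.tsum_mul_right,
          ENNReal.tsum_mul_right]
        refine add_le_add (add_le_add (hshift fun k : ℕ => (k : ℝ≥0∞) * tail p k)
          (add_le_add ?_ (mul_le_mul' (hshift _) le_rfl))) (mul_le_mul' ?_ le_rfl)
        · exact (hshift fun k : ℕ => ∫⁻ ω in noOut edge (n - k) k,
            reach edge (n - k) (Set.Iic n) ω ∂P).trans (hG.tsum_setLIntegral_noOut_reach_le hp n)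
        -- The restart probabilities add up to the probability that `n` is not drained.
        · rw [← measure_iUnion (disjoint_disjointed _) hFm', ← hF,
            prob_compl_eq_one_sub (hG.measurableSet_drained' _)]
          exact tsub_le_tsub_left (hdrained n) 1

/-- Go left to the first vertex that feeds everything to its right; this uses only edges starting at
or after it. The half-line estimate then applies independently. -/
theorem lintegral_skelDist_univ_ne_top (hG : IsLineModel p P edge)
    (hp : ∀ j : ℕ, 1 ≤ j → 0 ≤ p j ∧ p j < 1) (h1 : 0 < p 1)
    (h3 : ∑' k : ℕ, k * tail p k ≠ ∞) (n : ℤ) :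
    ∫⁻ ω, skelDist edge n Set.univ ω ∂P ≠ ∞ := by
  obtain ⟨c, hc, hc1, hfed, hdrained⟩ := hG.exists_pos_le_measure hp h1 h3
  have hT := hG.lintegral_feedDist_le hp hc hc1 hfed
  have hX := hG.lintegral_skelDist_le hp hc hc1 hdrained hT
  have hTtop : (∑' k : ℕ, k * tail p k) / c ≠ ∞ := ENNReal.div_ne_top h3 hc
  have hXtop := ENNReal.div_ne_top (ENNReal.add_ne_top.2 ⟨h3, ENNReal.add_ne_top.2
    ⟨tsum_tail_max_mul_tail_ne_top h3, ENNReal.mul_ne_top (tsum_tail_ne_top h3) hTtop⟩⟩) hc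
  have hAm : ∀ t : ℕ, MeasurableSet[edgeSigma edge {e | n - t ≤ e.1}]
      (disjointed (fun t : ℕ => fed edge (n - t) (n - t) Set.univ) t) := by
    refine fun t => measurableSet_disjointed fun l hl => measurableSet_fed fun i j _ h _ _ => ?_
    simp only [Set.mem_ofPred_eq]; omega
  have := setLIntegral_le_of_regeneration (P := P) (G := Set.univ) (c := 0)
    (A := fun t : ℕ => fed edge (n - t) (n - t) Set.univ)
    (V := skelDist edge n Set.univ)
    (U := fun t ω => skelDist edge (n - t) (Set.Iic (n - t)) ω)
    (fun t => edgeSigma edge {e | n - t ≤ e.1}) (fun t => edgeSigma edge {e | e.2 ≤ n - t})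
    (fun _ => hG.edgeSigma_le _) (fun _ => hG.edgeSigma_le _)
    (fun t => hG.indep_edgeSigma fun i j hij h h' => by simp at h h'; omega)
    (fun t => MeasurableSet.univ) hAm (fun t => hG.measurableSet_fed' _ _ _)
    (fun t => measurable_skelDist fun i j _ h => h.elim id id) (fun t => hX _)
    fun t ω _ ht => by
      rw [zero_add]; exact skelDist_le (mem_disjointed_iff.1 ht).1
  rw [Measure.restrict_univ, zero_mul, zero_add, measure_univ, one_mul] at this
  exact ne_top_of_le_ne_top
    (ENNReal.add_ne_top.2 ⟨ne_top_of_le_ne_top hTtop (hT n Set.univ), hXtop⟩) this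

end IsLineModel

theorem isGreatest_gammaZero {ω : Ω} {t : ℕ}
    (ht : ω ∈ disjointed (fun t : ℕ => fed edge (0 - t) (0 - t) Set.univ ∩
      drained edge (0 - t)) t) :
    IsGreatest (skeleton edge ω ∩ Set.Iic 0) (gammaZero edge ω) ∧ gammaZero edge ω = -t := by
  rw [mem_disjointed_iff] at ht
  have h : IsGreatest (skeleton edge ω ∩ Set.Iic 0) (-t : ℤ) := by
    refine ⟨⟨mem_skeleton_iff.2 (by simpa using ht.1), by simp⟩, ?_⟩
    rintro m ⟨hm, hm0⟩
    have hm0 : m ≤ 0 := hm0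
    by_contra hlt
    have hk : (0 : ℤ) - (-m).toNat = m := by omega
    refine ht.2 (-m).toNat (by omega) ?_
    rw [hk]
    exact mem_skeleton_iff.1 hm
  have : gammaZero edge ω = -t := h.csSup_eq
  exact ⟨this ▸ h, this⟩

theorem IsLineModel.gammaZero_integrable [MeasurableSpace Ω] {P : Measure Ω}
    [IsProbabilityMeasure P] {p : ℕ → ℝ} (hG : IsLineModel p P edge)
    (hp : ∀ j : ℕ, 1 ≤ j → 0 ≤ p j ∧ p j < 1) (h1 : 0 < p 1)
    (h3 : ∑' k : ℕ, k * tail p k ≠ ∞) :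
    (∀ᵐ ω ∂P, IsGreatest (skeleton edge ω ∩ Set.Iic 0) (gammaZero edge ω)) ∧
      Integrable (fun ω => (gammaZero edge ω : ℝ)) P := by
  have hfin := hG.lintegral_skelDist_univ_ne_top hp h1 h3 0
  have hm : Measurable (skelDist edge 0 Set.univ) :=
    (measurable_skelDist (S := Set.univ) fun _ _ _ _ => trivial).mono
      (hG.edgeSigma_le _) le_rfl
  have hae : ∀ᵐ ω ∂P, IsGreatest (skeleton edge ω ∩ Set.Iic 0) (gammaZero edge ω) ∧
      (gammaZero edge ω : ℝ) = -(skelDist edge 0 Set.univ ω).toReal := by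
    filter_upwards [ae_lt_top hm hfin] with ω hω
    have hex : ∃ t : ℕ, ω ∈ fed edge (0 - t) (0 - t) Set.univ ∩ drained edge (0 - t) := by
      by_contra hne
      -- An empty search has distance `∞`, so a finite expectation already yields almost sure
      -- existence.
      exact hω.ne (hit_eq_top (not_exists.1 hne))
    obtain ⟨t, ht⟩ := exists_mem_disjointed hex
    obtain ⟨hg, he⟩ := isGreatest_gammaZero ht
    refine ⟨hg, ?_⟩
    rw [he, skelDist, hit_eq_of_mem_disjointed ht]
    simp
  refine ⟨hae.mono fun ω h => h.1, ?_⟩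
  exact (integrable_toReal_of_lintegral_ne_top hm.aemeasurable hfin).neg.congr
    (hae.mono fun ω h => h.2.symm)

end Renewal

end LineModel

theorem mainTheorem5 (p : ℕ → ℝ) (hp : ∀ j : ℕ, 1 ≤ j → 0 ≤ p j ∧ p j < 1)
    {Ω : Type*} [MeasurableSpace Ω] (P : Measure Ω) [IsProbabilityMeasure P]
    (edge : ℤ → ℤ → Set Ω) (hG : LineModel.IsLineModel p P edge) :
    (∀ j : ℤ, LineModel.CondC3 p ↔
      ∫⁻ ω, ((LineModel.xi edge j ω : ℕ∞) : ℝ≥0∞) ^ 2 ∂P < ∞) ∧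
    (LineModel.CondC1 p → LineModel.CondC3 p →
      (∀ᵐ ω ∂P, IsGreatest (LineModel.skeleton edge ω ∩ Set.Iic 0)
        (LineModel.gammaZero edge ω)) ∧
      Integrable (fun ω => (LineModel.gammaZero edge ω : ℝ)) P) :=
  ⟨hG.condC3_iff_lintegral_xi_sq_lt_top hp, fun h1 h3 =>
    hG.gammaZero_integrable hp h1.1 ((LineModel.condC3_iff hp).1 h3)⟩
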